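/- **Setting.** Let $\lambda:\mathbb R\to(0,\infty)$ be locally integrable with $\int_{-\infty}^0\lambda\,dx=\int_0^\infty\lambda\,dx=\infty$. Let $\mathcal P_\lambda$ be the law of the Poisson point process on $\mathbb R$ with intensity $\lambda(x)\,dx$, regarded as a probability measure on doubly infinite, strictly increasing, locally finite sequences $z=(z_i)_{i\in\mathbb Z}$ labelled so that $z_0$ is the smallest positive point. Let $\mathcal T$ be the law of a stationary ergodic sequence $\eta=(\eta_i)_{i\in\mathbb Z}$ of positive random variables, and let $\mathcal S=\mathcal P_\lambda\times\mathcal T$ be the law of $\omega=(z_i,\eta_i)_{i\in\mathbb Z}$ (arrival moments and service times of customers at a single FIFO server). For $t,x\in\mathbb R$ let $\theta_t(x)$ be the unique real number with $\int_x^{\theta_t(x)}\lambda(s)\,ds=t$, and for $\omega=(z_i,\eta_i)_i$ put $\theta_t\omega=(\theta_t(z_i),\eta_i)_i$. **Exit moments.** For $\omega=(z_i,\eta_i)_{i\in\mathbb Z}$ (with $z$ not necessarily monotone) let $I(\omega)=\{i:\ z_i\ge z_{i-k}+\eta_{i-k}\text{ for all }k>0\}$. If $I(\omega)$ is unbounded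 below, let $R\omega=(Rz_j,\eta_j)_j$, where $Rz_j=z_j$ for $j\in I(\omega)$, and otherwise $Rz_j=z_i+\eta_i+\dots+\eta_{j-1}$ with $i=\max\{k\in I(\omega):k<j\}$. Let $\tilde\Omega$ be the set of those $\omega$ for which all iterates $R^n\omega$, $n\ge1$, are defined and, for every $j$, the sequence $(R^nz_j)_n$ is eventually constant; denote its eventual value by $\bar Rz_j$. For $\omega\in\tilde\Omega$ the exit moments are $y_i(\omega)=\bar Rz_i+\eta_i$, $i\in\mathbb Z$. For $x\in\mathbb R$ let $\mathfrak S(1,\omega,x)$ be the number of indices $i\in\mathbb Z$ such that $y_i(\omega)<x$ and $y_i(\theta_1\omega)>x$ (the number of exit moments that cross $x$ under the shift $\theta_t$, $t\in[0,1]$). **Theorem.** Suppose the no-overload property holds: $\mathcal S\big(\bigcap_{t\in\mathbb R}\theta_t\tilde\Omega\big)=1$. Then for every $x\in\mathbb R$ the random variable $\omega\mapsto\mathfrak S(1,\omega,x)$ is $\mathcal S$-almost everywhere equal to a measurable function, and $$\mathbb E\big(\mathfrak S(1,\omega,x)\big)=1 .$$ -/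

import Mathlib

open MeasureTheory ProbabilityTheory Filter Set
open scoped ENNReal NNReal

namespace FIFOQueue

noncomputable section

/-- The intensity measure `rate(x) dx` on the real line. -/
def intensity (rate : ℝ → ℝ) : Measure ℝ :=
  volume.withDensity (fun x => ENNReal.ofReal (rate x))

/-- Standing assumptions on the arrival rate: strictly positive, locally integrable, with infinite
mass near both `-∞` and `+∞`. -/
structure IsArrivalRate (rate : ℝ → ℝ) : Prop where
  pos : ∀ x, 0 < rate x
  locallyIntegrable : LocallyIntegrable rate volume
  mass_left : ∫⁻ x in Iic (0 : ℝ), ENNReal.ofReal (rate x) = ∞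
  mass_right : ∫⁻ x in Ici (0 : ℝ), ENNReal.ofReal (rate x) = ∞

/-- The number of points of the sequence `z` lying in `B`. -/
def pointCount (B : Set ℝ) (z : ℤ → ℝ) : ℕ∞ := {i : ℤ | z i ∈ B}.encard

/-- `P` is the law of the Poisson point process on `ℝ` with intensity `rate(x) dx`, viewed as a
measure on doubly infinite sequences: the points are listed in increasing order, form a locally
finite set, and `z 0` is the smallest positive point; the numbers of points in disjoint Borel sets
of finite intensity are independent, Poisson distributed with mean the intensity of the set. -/
structure IsPoissonProcess (rate : ℝ → ℝ) (P : Measure (ℤ → ℝ)) : Prop where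
  strictMono : ∀ᵐ z ∂P, StrictMono z
  tendsto_atTop : ∀ᵐ z ∂P, Tendsto z atTop atTop
  tendsto_atBot : ∀ᵐ z ∂P, Tendsto z atBot atBot
  labelling : ∀ᵐ z ∂P, z (-1) ≤ 0 ∧ 0 < z 0
  count_law : ∀ B : Set ℝ, MeasurableSet B → intensity rate B ≠ ∞ → ∀ n : ℕ,
    P {z | pointCount B z = n} = poissonMeasure (intensity rate B).toNNReal {n}
  count_indep : ∀ (n : ℕ) (B : Fin n → Set ℝ), (∀ k, MeasurableSet (B k)) →
    (∀ k, intensity rate (B k) ≠ ∞) → Pairwise (fun k l => Disjoint (B k) (B l)) →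
    iIndepFun (fun k => pointCount (B k)) P

/-- The shift of doubly infinite sequences by one index. -/
def seqShift (η : ℤ → ℝ) : ℤ → ℝ := fun i => η (i + 1)

/-- `T` is the law of a stationary ergodic sequence of positive service times. -/
structure IsServiceProcess (T : Measure (ℤ → ℝ)) : Prop where
  pos : ∀ᵐ η ∂T, ∀ i, 0 < η i
  ergodic : Ergodic seqShift T

/-- A configuration `ω = (z, η)`: arrival moments `z i` and service times `η i`. -/
abbrev Config := (ℤ → ℝ) × (ℤ → ℝ)

/-- The nonlinear shift `θ_t` of the line: the value `u` with `∫_x^u rate = t`. -/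
def lineShift (rate : ℝ → ℝ) (t x : ℝ) : ℝ :=
  Classical.epsilon (fun u => ∫ s in x..u, rate s = t)

/-- For an arrival rate there is exactly one value `u` as required in `lineShift`. -/
theorem existsUnique_lineShift {rate : ℝ → ℝ} (h : IsArrivalRate rate) (t x : ℝ) :
    ∃! u, ∫ s in x..u, rate s = t := by
  have hint : ∀ a b : ℝ, IntervalIntegrable rate volume a b := fun a b =>
    (h.locallyIntegrable.integrableOn_isCompact isCompact_uIcc).intervalIntegrable
  have hmono : StrictMono (fun u => ∫ s in x..u, rate s) := by
    intro a b hab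
    have h1 := intervalIntegral.integral_add_adjacent_intervals (hint x a) (hint a b)
    have h2 := intervalIntegral.intervalIntegral_pos_of_pos (hint a b) h.pos hab
    dsimp only
    linarith
  have hcont : Continuous (fun u => ∫ s in x..u, rate s) :=
    intervalIntegral.continuous_primitive hint x
  have hnorm : ∀ s, ‖rate s‖ = rate s := fun s => Real.norm_of_nonneg (h.pos s).le
  have hup : ∃ u, t < ∫ s in x..u, rate s := by
    by_contra! hb
    have hI : IntegrableOn rate (Ioi x) volume :=
      integrableOn_Ioi_of_intervalIntegral_norm_bounded t x
        (fun n : ℕ => (h.locallyIntegrable.integrableOn_isCompact isCompact_Icc).mono_set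
          (Ioc_subset_Icc_self (a := x) (b := (n : ℝ))))
        (tendsto_natCast_atTop_atTop) (Eventually.of_forall fun n => by simpa [hnorm] using hb n)
    have hJ : IntegrableOn rate (Ici (0 : ℝ)) volume :=
      ((h.locallyIntegrable.integrableOn_isCompact (isCompact_Icc (a := 0) (b := x))).union
        hI).mono_set (fun s (hs : (0 : ℝ) ≤ s) => (le_or_gt s x).imp (fun h' => ⟨hs, h'⟩) id)
    have := hJ.hasFiniteIntegral
    rw [hasFiniteIntegral_iff_ofReal (Eventually.of_forall fun s => (h.pos s).le)] at this
    exact this.ne h.mass_right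
  have hdown : ∃ u, ∫ s in x..u, rate s < t := by
    by_contra! hb
    have hI : IntegrableOn rate (Iic x) volume :=
      integrableOn_Iic_of_intervalIntegral_norm_bounded (-t) x
        (fun n : ℕ => (h.locallyIntegrable.integrableOn_isCompact isCompact_Icc).mono_set
          (Ioc_subset_Icc_self (a := -(n : ℝ)) (b := x)))
        (tendsto_neg_atTop_atBot.comp tendsto_natCast_atTop_atTop)
        (Eventually.of_forall fun n => by
          have := hb (-(n : ℝ))
          rw [intervalIntegral.integral_symm] at this
          simp only [hnorm]
          linarith)
    have hJ : IntegrableOn rate (Iic (0 : ℝ)) volume :=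
      ((h.locallyIntegrable.integrableOn_isCompact (isCompact_Icc (a := x) (b := 0))).union
        hI).mono_set (fun s (hs : s ≤ (0 : ℝ)) => (le_or_gt x s).imp (fun h' => ⟨h', hs⟩)
          (fun h' => h'.le))
    have := hJ.hasFiniteIntegral
    rw [hasFiniteIntegral_iff_ofReal (Eventually.of_forall fun s => (h.pos s).le)] at this
    exact this.ne h.mass_left
  obtain ⟨a, ha⟩ := hdown
  obtain ⟨b, hb⟩ := hup
  obtain ⟨u, hu⟩ := mem_range_of_exists_le_of_exists_ge hcont ⟨a, ha.le⟩ ⟨b, hb.le⟩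
  exact ⟨u, hu, fun v hv => hmono.injective (hv.trans hu.symm)⟩

/-- The nonlinear shift of configurations: arrivals are moved by `θ_t`, each customer keeps
its index and its service time. -/
def shift (rate : ℝ → ℝ) (t : ℝ) (ω : Config) : Config :=
  (fun i => lineShift rate t (ω.1 i), ω.2)

/-- The set `I(ω)` of indices of customers without conflicts with earlier customers. -/
def conflictFree (ω : Config) : Set ℤ :=
  {i | ∀ k : ℤ, 0 < k → ω.1 (i - k) + ω.2 (i - k) ≤ ω.1 i}

open Classical in
/-- One step `R` of conflict resolution. An index `j ∈ I(ω)` keeps its moment; otherwise, with `i`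
the last index of `I(ω)` before `j`, its moment becomes `z_i + η_i + ⋯ + η_{j-1}`. -/
def resolveStep (ω : Config) : Config :=
  (fun j => if j ∈ conflictFree ω then ω.1 j
    else ω.1 (sSup (conflictFree ω ∩ Iio j)) +
      ∑ m ∈ Finset.Ico (sSup (conflictFree ω ∩ Iio j)) j, ω.2 m, ω.2)

/-- The conflict resolution operator is defined at `ω`: all iterates `Rⁿ ω` are defined
(every index has a conflict-free one before it, which is all that the formula for `R` uses), and
they stabilize at every index. -/
def Resolvable (ω : Config) : Prop :=
  (∀ n : ℕ, ¬ BddBelow (conflictFree (resolveStep^[n] ω))) ∧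
  ∀ j : ℤ, ∃ n : ℕ, ∀ m : ℕ, n ≤ m → (resolveStep^[m] ω).1 j = (resolveStep^[n] ω).1 j

/-- The stable value of `Rⁿ z_j`: the moment at which the service of customer `j` begins. -/
def serviceStart (ω : Config) (j : ℤ) : ℝ :=
  Classical.epsilon (fun v => ∀ᶠ n : ℕ in atTop, (resolveStep^[n] ω).1 j = v)

/-- The exit moment `y_i(ω)` of customer `i`. -/
def exitMoment (ω : Config) (i : ℤ) : ℝ := serviceStart ω i + ω.2 i

/-- The no-overload property: for almost every `ω`, conflict resolution is defined at `θ_t ω` for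
all real `t` simultaneously. -/
def NoOverload (rate : ℝ → ℝ) (S : Measure Config) : Prop :=
  ∀ᵐ ω ∂S, ∀ t : ℝ, Resolvable (shift rate t ω)

/-- The number `𝔖(T, ω, x)` of exits that cross `x` from left to right when `ω` is shifted
to `θ_T ω`, for `T ≥ 0`. -/
def exitCrossings (rate : ℝ → ℝ) (T : ℝ) (ω : Config) (x : ℝ) : ℕ∞ :=
  {i : ℤ | exitMoment ω i < x ∧ x < exitMoment (shift rate T ω) i}.encard

end

end FIFOQueue

namespace FIFOQueue

/-! ### The flow `lineShift` and the invariance of the intensity. -/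

section LineShift

variable {rate : ℝ → ℝ}

/-! The proof is a conservation law combined with stationarity of the queue. Shifting by `θ_1` moves
arrivals and exits to the right. The customers who have arrived before `x` in the old configuration
but leave at or after `x` in the new one can be counted in two ways, which gives (arrivals crossing
`x`) + (new queue at `x`) = (exits crossing `x`) + (old queue at `x`). This is
`Resolvable.conservation`; it rests on the formula `y_i = max_{k ≤ i} (z_k + η_k + ⋯ + η_i)` for the
exit moments, proved in `Resolvable.busyExit_le` and `Resolvable.exists_exitMoment_eq`.

The old and new queues at `x` have the same law (`lintegral_present_shift`): `θ_t` preserves the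
intensity, hence the Poisson process up to relabelling, and stationarity of the service times
absorbs the relabelling. The queue is almost surely finite but its mean may be infinite, so the two
queue terms are removed by truncation (`lintegral_le_of_add_eq`). The mean number of exits therefore
equals the mean number of arrivals crossing `x`, which is the intensity of `[θ_{-1} x, x)`, that is
`1`. -/

theorem IsArrivalRate.intervalIntegrable (h : IsArrivalRate rate) (a b : ℝ) :
    IntervalIntegrable rate volume a b :=
  (h.locallyIntegrable.integrableOn_isCompact isCompact_uIcc).intervalIntegrable

theorem IsArrivalRate.integral_strictMono (h : IsArrivalRate rate) (x : ℝ) :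
    StrictMono (fun u => ∫ s in x..u, rate s) := by
  intro a b hab
  have h1 := intervalIntegral.integral_add_adjacent_intervals
    (h.intervalIntegrable x a) (h.intervalIntegrable a b)
  have h2 := intervalIntegral.intervalIntegral_pos_of_pos (h.intervalIntegrable a b) h.pos hab
  dsimp only
  linarith

theorem IsArrivalRate.integral_lineShift (h : IsArrivalRate rate) (t x : ℝ) :
    ∫ s in x..lineShift rate t x, rate s = t :=
  Classical.epsilon_spec (p := fun u => ∫ s in x..u, rate s = t) (existsUnique_lineShift h t x).exists

theorem IsArrivalRate.eq_lineShift (h : IsArrivalRate rate) {t x u : ℝ}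
    (hu : ∫ s in x..u, rate s = t) : lineShift rate t x = u :=
  (h.integral_strictMono x).injective ((h.integral_lineShift t x).trans hu.symm)

theorem IsArrivalRate.lineShift_zero (h : IsArrivalRate rate) (x : ℝ) : lineShift rate 0 x = x :=
  h.eq_lineShift intervalIntegral.integral_same

theorem IsArrivalRate.lineShift_lineShift (h : IsArrivalRate rate) (s t x : ℝ) :
    lineShift rate s (lineShift rate t x) = lineShift rate (t + s) x := by
  refine (h.eq_lineShift ?_).symm
  rw [← intervalIntegral.integral_add_adjacent_intervals
    (h.intervalIntegrable x (lineShift rate t x)) (h.intervalIntegrable _ _),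
    h.integral_lineShift, h.integral_lineShift]

theorem IsArrivalRate.lineShift_neg_lineShift (h : IsArrivalRate rate) (t x : ℝ) :
    lineShift rate (-t) (lineShift rate t x) = x := by
  rw [h.lineShift_lineShift, add_neg_cancel, h.lineShift_zero]

theorem IsArrivalRate.le_lineShift (h : IsArrivalRate rate) {t : ℝ} (ht : 0 ≤ t) (x : ℝ) :
    x ≤ lineShift rate t x := by
  rw [← (h.integral_strictMono x).le_iff_le]
  simpa [h.integral_lineShift] using ht

theorem IsArrivalRate.strictMono_lineShift (h : IsArrivalRate rate) (t : ℝ) :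
    StrictMono (lineShift rate t) := by
  intro a b hab
  rw [← (h.integral_strictMono a).lt_iff_lt]
  have h1 := intervalIntegral.integral_add_adjacent_intervals
    (h.intervalIntegrable a b) (h.intervalIntegrable b (lineShift rate t b))
  have h2 := intervalIntegral.intervalIntegral_pos_of_pos (h.intervalIntegrable a b) h.pos hab
  rw [h.integral_lineShift] at h1
  simp only [h.integral_lineShift]
  linarith

theorem IsArrivalRate.measurable_lineShift (h : IsArrivalRate rate) (t : ℝ) :
    Measurable (lineShift rate t) :=
  (h.strictMono_lineShift t).monotone.measurable

theorem IsArrivalRate.lineShift_lt_iff (h : IsArrivalRate rate) {t x y : ℝ} :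
    lineShift rate t x < y ↔ x < lineShift rate (-t) y := by
  rw [← (h.strictMono_lineShift (-t)).lt_iff_lt, h.lineShift_neg_lineShift]

theorem IsArrivalRate.le_lineShift_iff (h : IsArrivalRate rate) {t x y : ℝ} :
    y ≤ lineShift rate t x ↔ lineShift rate (-t) y ≤ x := by
  simpa using h.lineShift_lt_iff.not

theorem IsArrivalRate.intensity_Ioc (h : IsArrivalRate rate) {a b : ℝ} (hab : a ≤ b) :
    intensity rate (Ioc a b) = ENNReal.ofReal (∫ s in a..b, rate s) := by
  rw [intensity, withDensity_apply _ measurableSet_Ioc, intervalIntegral.integral_of_le hab,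
    ofReal_integral_eq_lintegral_ofReal (h.intervalIntegrable a b).1
      (Eventually.of_forall fun s => (h.pos s).le)]

theorem IsArrivalRate.intensity_singleton (x : ℝ) : intensity rate {x} = 0 :=
  withDensity_absolutelyContinuous _ _ (measure_singleton x)

theorem IsArrivalRate.isLocallyFiniteMeasure (h : IsArrivalRate rate) :
    IsLocallyFiniteMeasure (intensity rate) := by
  refine ⟨fun x => ⟨Ioc (x - 1) (x + 1), Ioc_mem_nhds (by linarith) (by linarith), ?_⟩⟩
  rw [h.intensity_Ioc (by linarith)]
  exact ENNReal.ofReal_lt_top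

/-- In the coordinate given by a primitive of `rate`, the map `θ_t` is translation by `t` and the
intensity is Lebesgue measure. It suffices to compare half-open intervals. -/
theorem IsArrivalRate.map_lineShift_intensity (h : IsArrivalRate rate) (t : ℝ) :
    (intensity rate).map (lineShift rate t) = intensity rate := by
  have := h.isLocallyFiniteMeasure
  refine (Measure.ext_of_Ioc _ _ fun a b hab => ?_).symm
  have hp : lineShift rate t ⁻¹' Ioc a b = Ioc (lineShift rate (-t) a) (lineShift rate (-t) b) := by
    ext x
    have h1 := (h.lineShift_lt_iff (t := -t) (x := a) (y := x))
    have h2 := (h.le_lineShift_iff (t := -t) (x := b) (y := x))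
    rw [neg_neg] at h1 h2
    simp only [mem_preimage, mem_Ioc, h1, h2]
  rw [Measure.map_apply (h.measurable_lineShift t) measurableSet_Ioc, hp, h.intensity_Ioc hab.le,
    h.intensity_Ioc ((h.strictMono_lineShift (-t)).monotone hab.le)]
  congr 1
  have h1 := intervalIntegral.integral_add_adjacent_intervals
    (h.intervalIntegrable a b) (h.intervalIntegrable b (lineShift rate (-t) b))
  have h2 := intervalIntegral.integral_add_adjacent_intervals
    (h.intervalIntegrable a (lineShift rate (-t) a))
    (h.intervalIntegrable (lineShift rate (-t) a) (lineShift rate (-t) b))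
  rw [h.integral_lineShift] at h1 h2
  linarith

theorem IsArrivalRate.intensity_preimage_lineShift (h : IsArrivalRate rate) (t : ℝ) {B : Set ℝ}
    (hB : MeasurableSet B) : intensity rate (lineShift rate t ⁻¹' B) = intensity rate B := by
  rw [← Measure.map_apply (h.measurable_lineShift t) hB, h.map_lineShift_intensity]

theorem IsArrivalRate.intensity_Ico_lineShift (h : IsArrivalRate rate) (x : ℝ) :
    intensity rate (Ico (lineShift rate (-1) x) x) = 1 := by
  have hle : lineShift rate (-1) x ≤ x := by
    rw [← h.le_lineShift_iff]; exact h.le_lineShift zero_le_one x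
  have hae : intensity rate (Ico (lineShift rate (-1) x) x)
      = intensity rate (Ioc (lineShift rate (-1) x) x) :=
    measure_congr ((withDensity_absolutelyContinuous _ _).ae_le Ico_ae_eq_Ioc)
  rw [hae, h.intensity_Ioc hle, intervalIntegral.integral_symm, h.integral_lineShift]
  simp

end LineShift

/-! ### Conflict resolution, the maximum formula for exits, and conservation of customers. -/

section Resolve

/-- The moment at which customer `i` leaves if the server is busy from the arrival of customer `k`
until then. -/
noncomputable def busyExit (ω : Config) (k i : ℤ) : ℝ := ω.1 k + ∑ m ∈ Finset.Icc k i, ω.2 m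

theorem sum_Ico_add_sum_Ico (η : ℤ → ℝ) {i j k : ℤ} (hij : i ≤ j) (hjk : j ≤ k) :
    ∑ m ∈ Finset.Ico i j, η m + ∑ m ∈ Finset.Ico j k, η m = ∑ m ∈ Finset.Ico i k, η m := by
  rw [← Finset.sum_union (Finset.Ico_disjoint_Ico_consecutive i j k),
    Finset.Ico_union_Ico_eq_Ico hij hjk]

theorem sum_Ico_succ (η : ℤ → ℝ) {i j : ℤ} (hij : i ≤ j) :
    ∑ m ∈ Finset.Ico i (j + 1), η m = ∑ m ∈ Finset.Ico i j, η m + η j := by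
  rw [← sum_Ico_add_sum_Ico η hij (by lia : j ≤ j + 1)]
  congr 1
  rw [Finset.sum_eq_single_of_mem j (by simp)]
  intro b hb hne
  simp only [Finset.mem_Ico] at hb
  lia

theorem busyExit_eq (ω : Config) (k i : ℤ) :
    busyExit ω k i = ω.1 k + ∑ m ∈ Finset.Ico k (i + 1), ω.2 m := by
  have : Finset.Icc k i = Finset.Ico k (i + 1) := by ext; simp
  rw [busyExit, this]

theorem resolveStep_snd (ω : Config) : (resolveStep ω).2 = ω.2 := rfl

theorem iterate_resolveStep_snd (ω : Config) (n : ℕ) : (resolveStep^[n] ω).2 = ω.2 := by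
  induction n with
  | zero => rfl
  | succ n ih => rw [Function.iterate_succ_apply', resolveStep_snd, ih]

/-- Unboundedness below makes the set nonempty, so the supremum is a true maximum and not the
default value of `sSup` on `ℤ`. -/
theorem csSup_conflictFree_mem {ω : Config} (hω : ¬ BddBelow (conflictFree ω)) (j : ℤ) :
    sSup (conflictFree ω ∩ Iio j) ∈ conflictFree ω ∩ Iio j := by
  refine Int.csSup_mem ?_ ⟨j, fun i hi => hi.2.le⟩
  obtain ⟨i, hi, hij⟩ := not_bddBelow_iff.1 hω j
  exact ⟨i, hi, hij⟩

theorem le_csSup_conflictFree {ω : Config} {i j : ℤ} (hi : i ∈ conflictFree ω) (hij : i < j) :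
    i ≤ sSup (conflictFree ω ∩ Iio j) :=
  le_csSup ⟨j, fun _ hi => hi.2.le⟩ ⟨hi, hij⟩

theorem csSup_conflictFree_eq {ω : Config} (hω : ¬ BddBelow (conflictFree ω)) {l j : ℤ}
    (hl : l ∉ conflictFree ω) (hlj : l ≤ j)
    (h : sSup (conflictFree ω ∩ Iio j) ≤ l) :
    sSup (conflictFree ω ∩ Iio l) = sSup (conflictFree ω ∩ Iio j) := by
  have h1 := csSup_conflictFree_mem hω j
  have h2 := csSup_conflictFree_mem hω l
  refine le_antisymm (le_csSup_conflictFree h2.1 (h2.2.trans_le hlj))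
    (le_csSup_conflictFree h1.1 (lt_of_le_of_ne h ?_))
  rintro rfl
  exact hl h1.1

theorem resolveStep_of_mem {ω : Config} {j : ℤ} (h : j ∈ conflictFree ω) :
    (resolveStep ω).1 j = ω.1 j := if_pos h

theorem resolveStep_of_notMem {ω : Config} {j : ℤ} (h : j ∉ conflictFree ω) :
    (resolveStep ω).1 j = ω.1 (sSup (conflictFree ω ∩ Iio j)) +
      ∑ m ∈ Finset.Ico (sSup (conflictFree ω ∩ Iio j)) j, ω.2 m := if_neg h

/-- All indices from a conflict-free leader up to `j` share that leader, so after one step they are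
served back to back. -/
theorem resolveStep_of_notMem_of_le {ω : Config} (hω : ¬ BddBelow (conflictFree ω)) {l j : ℤ}
    (hj : j ∉ conflictFree ω) (hlj : l ≤ j) (h : sSup (conflictFree ω ∩ Iio j) ≤ l) :
    (resolveStep ω).1 j = (resolveStep ω).1 l + ∑ m ∈ Finset.Ico l j, ω.2 m := by
  by_cases hl : l ∈ conflictFree ω
  · have : sSup (conflictFree ω ∩ Iio j) = l := by
      refine le_antisymm h (le_csSup_conflictFree hl (lt_of_le_of_ne hlj ?_))
      rintro rfl
      exact hj hl
    rw [resolveStep_of_mem hl, resolveStep_of_notMem hj, this]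
  · rw [resolveStep_of_notMem hj, resolveStep_of_notMem hl, csSup_conflictFree_eq hω hl hlj h,
      add_assoc, sum_Ico_add_sum_Ico _ h hlj]

/-- Strong induction on the distance from the conflict-free leader `i`. If `l` conflicts with a
customer before `i`, that customer is done by `z_i`, and `Rz_l ≥ z_i`. If it conflicts with one at
or after `i`, the induction hypothesis for that customer and back-to-back service push `Rz_l` past
the conflict. -/
theorem le_resolveStep {ω : Config} (hη : ∀ i, 0 ≤ ω.2 i) (hω : ¬ BddBelow (conflictFree ω))
    (j : ℤ) : ω.1 j ≤ (resolveStep ω).1 j := by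
  by_cases hj : j ∈ conflictFree ω
  · exact (resolveStep_of_mem hj).ge
  set i := sSup (conflictFree ω ∩ Iio j) with hi
  obtain ⟨him, hij⟩ := csSup_conflictFree_mem hω j
  have key : ∀ d : ℕ, ∀ l, l = i + d → l ≤ j → ω.1 l ≤ (resolveStep ω).1 l := by
    intro d
    induction d using Nat.strong_induction_on with
    | _ d ih =>
      intro l hl hlj
      by_cases hlm : l ∈ conflictFree ω
      · exact (resolveStep_of_mem hlm).ge
      have hil : sSup (conflictFree ω ∩ Iio l) = i := csSup_conflictFree_eq hω hlm hlj (by lia)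
      obtain ⟨k, hk, hlt⟩ : ∃ k : ℤ, 0 < k ∧ ω.1 l < ω.1 (l - k) + ω.2 (l - k) := by
        simpa [conflictFree] using hlm
      by_cases hki : l - k < i
      · have h1 := him (i - (l - k)) (by lia)
        rw [show sSup (conflictFree ω ∩ Iio j) = i from rfl, sub_sub_cancel] at h1
        rw [resolveStep_of_notMem hlm, hil]
        have := Finset.sum_nonneg (s := Finset.Ico i l) (f := ω.2) (fun m _ => hη m)
        linarith
      · push Not at hki
        have h1 := ih (l - k - i).toNat (by lia) (l - k) (by lia) (by lia)
        have h2 := resolveStep_of_notMem_of_le hω hlm (by lia : l - k ≤ l) (by rw [hil]; exact hki)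
        have h3 : ω.2 (l - k) ≤ ∑ m ∈ Finset.Ico (l - k) l, ω.2 m :=
          Finset.single_le_sum (f := ω.2) (fun m _ => hη m) (by simp; lia)
        linarith
  exact key (j - i).toNat j (by have : i < j := hij; lia) le_rfl

theorem resolveStep_add_le {ω : Config} (hω : ¬ BddBelow (conflictFree ω)) {j : ℤ}
    (h1 : (resolveStep ω).1 j = ω.1 j) :
    ω.1 j + ω.2 j ≤ (resolveStep ω).1 (j + 1) := by
  by_cases hj : j + 1 ∈ conflictFree ω
  · have := hj 1 one_pos
    rw [resolveStep_of_mem hj]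
    simpa using this
  · have hlt := (csSup_conflictFree_mem hω (j + 1)).2
    have := resolveStep_of_notMem_of_le hω hj (by lia : j ≤ j + 1) (Int.lt_add_one_iff.1 hlt)
    rw [sum_Ico_succ _ le_rfl] at this
    simp at this
    rw [this, h1]

/-- Replacing a moment by the leader's moment plus the services in between preserves this form,
since adjacent sums of service times concatenate. -/
theorem exists_iterate_resolveStep_eq {ω : Config}
    (hω : ∀ n : ℕ, ¬ BddBelow (conflictFree (resolveStep^[n] ω))) (n : ℕ) (j : ℤ) :
    ∃ k ≤ j, (resolveStep^[n] ω).1 j = ω.1 k + ∑ m ∈ Finset.Ico k j, ω.2 m := by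
  induction n generalizing j with
  | zero => exact ⟨j, le_rfl, by simp⟩
  | succ n ih =>
    rw [Function.iterate_succ_apply']
    by_cases hj : j ∈ conflictFree (resolveStep^[n] ω)
    · rw [resolveStep_of_mem hj]
      exact ih j
    · have hlt : _ < j := (csSup_conflictFree_mem (hω n) j).2
      obtain ⟨k, hk, h⟩ := ih (sSup (conflictFree (resolveStep^[n] ω) ∩ Iio j))
      refine ⟨k, hk.trans hlt.le, ?_⟩
      rw [resolveStep_of_notMem hj, h, iterate_resolveStep_snd, add_assoc,
        sum_Ico_add_sum_Ico _ hk hlt.le]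

theorem Resolvable.eventually_eq_serviceStart {ω : Config} (h : Resolvable ω) (j : ℤ) :
    ∀ᶠ n : ℕ in atTop, (resolveStep^[n] ω).1 j = serviceStart ω j := by
  obtain ⟨n, hn⟩ := h.2 j
  exact Classical.epsilon_spec
    (p := fun v => ∀ᶠ n : ℕ in atTop, (resolveStep^[n] ω).1 j = v)
    ⟨_, eventually_atTop.2 ⟨n, hn⟩⟩

theorem Resolvable.le_serviceStart {ω : Config} (h : Resolvable ω) (hη : ∀ i, 0 ≤ ω.2 i) (j : ℤ) :
    ω.1 j ≤ serviceStart ω j := by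
  obtain ⟨n, hn⟩ := (h.eventually_eq_serviceStart j).exists
  rw [← hn]
  clear hn
  induction n with
  | zero => exact le_rfl
  | succ n ih =>
    rw [Function.iterate_succ_apply']
    exact ih.trans (le_resolveStep (by rwa [iterate_resolveStep_snd]) (h.1 n) j)

/-- Once customers `j` and `j + 1` have reached their stable values, a further step leaves `j`
fixed, so it places `j + 1` no earlier than the end of service of `j`. -/
theorem Resolvable.serviceStart_add_le {ω : Config} (h : Resolvable ω)
    (j : ℤ) : serviceStart ω j + ω.2 j ≤ serviceStart ω (j + 1) := by
  have h1 := h.eventually_eq_serviceStart j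
  have h2 := h.eventually_eq_serviceStart (j + 1)
  obtain ⟨n, hn1, hn2, hn3⟩ := (h1.and (((tendsto_add_atTop_nat 1).eventually h1).and
    ((tendsto_add_atTop_nat 1).eventually h2))).exists
  rw [Function.iterate_succ_apply'] at hn2 hn3
  have := resolveStep_add_le (h.1 n) (hn2.trans hn1.symm)
  rwa [hn1, hn3, iterate_resolveStep_snd] at this

theorem Resolvable.serviceStart_add_sum_le {ω : Config} (h : Resolvable ω)
    {k j : ℤ} (hkj : k ≤ j) :
    serviceStart ω k + ∑ m ∈ Finset.Ico k j, ω.2 m ≤ serviceStart ω j := by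
  induction j, hkj using Int.leInduction with
  | base => simp
  | succ j hkj ih =>
    have := h.serviceStart_add_le j
    rw [sum_Ico_succ _ hkj]
    linarith

theorem Resolvable.busyExit_le {ω : Config} (h : Resolvable ω) (hη : ∀ i, 0 ≤ ω.2 i)
    {k i : ℤ} (hki : k ≤ i) : busyExit ω k i ≤ exitMoment ω i := by
  rw [busyExit_eq, sum_Ico_succ _ hki, exitMoment]
  have h1 := h.le_serviceStart hη k
  have h2 := h.serviceStart_add_sum_le hki
  linarith

/-- With `Resolvable.busyExit_le` this makes the exit moment the maximum of `busyExit ω k i` over `k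
≤ i`, which yields monotonicity in the arrivals and measurability. -/
theorem Resolvable.exists_exitMoment_eq {ω : Config} (h : Resolvable ω) (i : ℤ) :
    ∃ k ≤ i, exitMoment ω i = busyExit ω k i := by
  obtain ⟨n, hn⟩ := (h.eventually_eq_serviceStart i).exists
  obtain ⟨k, hk, hk'⟩ := exists_iterate_resolveStep_eq h.1 n i
  refine ⟨k, hk, ?_⟩
  rw [busyExit_eq, sum_Ico_succ _ hk, exitMoment, ← hn, hk', add_assoc]

theorem Resolvable.lt_exitMoment_iff {ω : Config} (h : Resolvable ω) (hη : ∀ i, 0 ≤ ω.2 i)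
    {i : ℤ} {x : ℝ} : x < exitMoment ω i ↔ ∃ k ≤ i, x < busyExit ω k i := by
  constructor
  · intro hx
    obtain ⟨k, hk, he⟩ := h.exists_exitMoment_eq i
    exact ⟨k, hk, he ▸ hx⟩
  · rintro ⟨k, hk, hx⟩
    exact hx.trans_le (h.busyExit_le hη hk)

theorem Resolvable.le_exitMoment_iff {ω : Config} (h : Resolvable ω) (hη : ∀ i, 0 ≤ ω.2 i)
    {i : ℤ} {x : ℝ} : x ≤ exitMoment ω i ↔ ∃ k ≤ i, x ≤ busyExit ω k i := by
  constructor
  · intro hx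
    obtain ⟨k, hk, he⟩ := h.exists_exitMoment_eq i
    exact ⟨k, hk, he ▸ hx⟩
  · rintro ⟨k, hk, hx⟩
    exact hx.trans (h.busyExit_le hη hk)

/-- The indices of the customers present in the system at time `x`. -/
def present (x : ℝ) (ω : Config) : Set ℤ := {i | ω.1 i < x ∧ ∃ k ≤ i, x ≤ busyExit ω k i}

theorem Resolvable.finite_present {ω : Config} (h : Resolvable ω) (hη : ∀ i, 0 ≤ ω.2 i)
    (htop : Tendsto ω.1 atTop atTop) (hbot : Tendsto ω.1 atBot atBot) (x : ℝ) :
    (present x ω).Finite := by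
  obtain ⟨b, hb⟩ := (htop.eventually_ge_atTop x).exists_forall_of_atTop
  obtain ⟨j, hj⟩ := eventually_atBot.1 (hbot.eventually_lt_atBot x)
  obtain ⟨k, hkj, hk⟩ := h.exists_exitMoment_eq j
  refine (Set.finite_Icc k b).subset fun i ⟨hi, l, hli, hl⟩ => ⟨?_, ?_⟩
  -- The maximum for `j` is attained at `k`. Comparing it with the value at `l ≤ i < k` and
  -- cancelling the services from `k` to `j` shows that work started at `l` is finished through `i`
  -- by `z_k < x`.
  · by_contra! hik
    have h1 := h.busyExit_le hη (hli.trans (hik.le.trans hkj))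
    rw [hk, busyExit_eq, busyExit_eq, ← sum_Ico_add_sum_Ico _ (by lia : l ≤ k) (by lia : k ≤ j + 1),
      ← sum_Ico_add_sum_Ico _ (by lia : l ≤ i + 1) (by lia : i + 1 ≤ k)] at h1
    have h2 := Finset.sum_nonneg (s := Finset.Ico (i + 1) k) (f := ω.2) (fun m _ => hη m)
    rw [busyExit_eq] at hl
    have := hj k hkj
    linarith
  · by_contra! hbi
    exact (hb i hbi.le).not_gt hi

/-- Conservation of customers to the left of `x` under an increase of all arrival moments. -/
theorem Resolvable.conservation {ω ω' : Config} (h : Resolvable ω) (h' : Resolvable ω')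
    (hη : ∀ i, 0 ≤ ω.2 i) (hsnd : ω'.2 = ω.2) (hle : ∀ i, ω.1 i ≤ ω'.1 i) (x : ℝ) :
    {i | ω.1 i < x ∧ x ≤ ω'.1 i}.encard + (present x ω').encard =
      {i | exitMoment ω i < x ∧ x ≤ exitMoment ω' i}.encard + (present x ω).encard := by
  have hη' : ∀ i, 0 ≤ ω'.2 i := by rwa [hsnd]
  have hp : present x ω = {i | ω.1 i < x ∧ x ≤ exitMoment ω i} := by
    ext i; simp only [present, mem_ofPred_eq, h.le_exitMoment_iff hη]
  have hp' : present x ω' = {i | ω'.1 i < x ∧ x ≤ exitMoment ω' i} := by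
    ext i; simp only [present, mem_ofPred_eq, h'.le_exitMoment_iff hη']
  have hz : ∀ {ω : Config}, Resolvable ω → (∀ i, 0 ≤ ω.2 i) → ∀ i, ω.1 i ≤ exitMoment ω i :=
    fun h hη i => (h.le_serviceStart hη i).trans (le_add_of_nonneg_right (hη i))
  have hmono : ∀ i, exitMoment ω i ≤ exitMoment ω' i := fun i => by
    obtain ⟨k, hk, he⟩ := h.exists_exitMoment_eq i
    rw [he]
    refine le_trans ?_ (h'.busyExit_le hη' hk)
    simp only [busyExit, hsnd]
    linarith [hle k]
  -- Both sides are disjoint decompositions of the set of `i` with `z_i < x ≤ y'_i`: the left one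
  -- splits according to `z'_i < x`, the right one according to `y_i < x`.
  rw [hp, hp', ← encard_union_eq, ← encard_union_eq]
  · congr 1
    ext i
    have h1 := hz h hη i
    have h2 := hz h' hη' i
    have h3 := hle i
    have h4 := hmono i
    simp only [mem_union, mem_ofPred_eq]
    constructor
    · rintro (⟨ha, hb⟩ | ⟨ha, hb⟩)
      · by_cases hc : exitMoment ω i < x
        · exact Or.inl ⟨hc, hb.trans h2⟩
        · exact Or.inr ⟨ha, not_lt.1 hc⟩
      · by_cases hc : exitMoment ω i < x
        · exact Or.inl ⟨hc, hb⟩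
        · exact Or.inr ⟨h3.trans_lt ha, not_lt.1 hc⟩
    · rintro (⟨ha, hb⟩ | ⟨ha, hb⟩)
      · by_cases hc : ω'.1 i < x
        · exact Or.inr ⟨hc, hb⟩
        · exact Or.inl ⟨h1.trans_lt ha, not_lt.1 hc⟩
      · by_cases hc : ω'.1 i < x
        · exact Or.inr ⟨hc, hb.trans h4⟩
        · exact Or.inl ⟨ha, not_lt.1 hc⟩
  · exact disjoint_left.2 fun i hi hi' => (hi'.2.trans_lt hi.1).false
  · exact disjoint_left.2 fun i hi hi' => (hi.2.trans_lt hi'.1).false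

end Resolve

/-! ### Laws of Poisson counts, for single sets and jointly. -/

section Counting

theorem measurable_encard {α : Type*} [MeasurableSpace α] {p : ℤ → α → Prop}
    (hp : ∀ i, MeasurableSet {a | p i a}) :
    Measurable (fun a => {i : ℤ | p i a}.encard) := by
  have h1 : Measurable (fun a => (({i : ℤ | p i a}.encard : ℕ∞) : ℝ≥0∞)) := by
    have : (fun a => (({i : ℤ | p i a}.encard : ℕ∞) : ℝ≥0∞)) =
        fun a => ∑' i : ℤ, {a | p i a}.indicator (fun _ => (1 : ℝ≥0∞)) a := by
      funext a
      rw [← ENNReal.tsum_set_one, tsum_subtype {i : ℤ | p i a} (fun _ => (1 : ℝ≥0∞))]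
      rfl
    rw [this]
    exact Measurable.tsum fun i => measurable_const.indicator (hp i)
  refine measurable_to_countable' fun n => ?_
  have : (fun a => {i : ℤ | p i a}.encard) ⁻¹' {n} =
      (fun a => (({i : ℤ | p i a}.encard : ℕ∞) : ℝ≥0∞)) ⁻¹' {(n : ℝ≥0∞)} := by
    ext a; simp
  rw [this]
  exact h1 (measurableSet_singleton _)

theorem measurable_toENNReal : Measurable (fun n : ℕ∞ => (n : ℝ≥0∞)) := measurable_from_top

theorem measurable_pointCount {B : Set ℝ} (hB : MeasurableSet B) : Measurable (pointCount B) :=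
  measurable_encard fun i => measurable_pi_apply i hB

/-- The law of the number of points in a set of finite intensity `r`. -/
theorem IsPoissonProcess.map_pointCount {rate : ℝ → ℝ} {P : Measure (ℤ → ℝ)}
    [IsProbabilityMeasure P] (hP : IsPoissonProcess rate P) {B : Set ℝ} (hB : MeasurableSet B)
    (hfin : intensity rate B ≠ ∞) :
    P.map (pointCount B) =
      (poissonMeasure (intensity rate B).toNNReal).map (Nat.cast : ℕ → ℕ∞) := by
  have hm := measurable_pointCount hB
  have := Measure.isProbabilityMeasure_map (μ := P) hm.aemeasurable
  have hc : Measurable (Nat.cast : ℕ → ℕ∞) := measurable_from_top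
  have := Measure.isProbabilityMeasure_map
    (μ := poissonMeasure (intensity rate B).toNNReal) hc.aemeasurable
  have hnat : ∀ n : ℕ, P.map (pointCount B) {(n : ℕ∞)} =
      (poissonMeasure (intensity rate B).toNNReal).map (Nat.cast : ℕ → ℕ∞) {(n : ℕ∞)} := by
    intro n
    rw [Measure.map_apply hm (measurableSet_singleton _),
      Measure.map_apply hc (measurableSet_singleton _)]
    have : (Nat.cast : ℕ → ℕ∞) ⁻¹' {(n : ℕ∞)} = {n} := by ext; simp
    rw [this]
    exact hP.count_law B hB hfin n
  refine Measure.ext_of_singleton fun n => ?_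
  induction n using ENat.recTopCoe with
  | coe n => exact hnat n
  -- The finite values already match, and both measures have total mass one, so the masses at `⊤`
  -- agree.
  | top =>
    have hcompl : ({⊤} : Set ℕ∞) = (⋃ n : ℕ, {(n : ℕ∞)})ᶜ := by
      ext n
      induction n using ENat.recTopCoe <;> simp
    have hmeas : MeasurableSet (⋃ n : ℕ, {(n : ℕ∞)}) := .of_discrete
    have hd : Pairwise (Function.onFun Disjoint fun n : ℕ => ({(n : ℕ∞)} : Set ℕ∞)) := by
      intro a b hab
      simpa using hab
    rw [hcompl, prob_compl_eq_one_sub hmeas, prob_compl_eq_one_sub hmeas,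
      measure_iUnion hd (fun _ => .of_discrete), measure_iUnion hd (fun _ => .of_discrete)]
    simp only [hnat]

theorem lintegral_poissonMeasure_cast (r : ℝ≥0) :
    ∫⁻ n, (n : ℝ≥0∞) ∂(poissonMeasure r) = r := by
  have h1 : HasSum (fun n : ℕ => (n : ℝ) * (Real.exp (-r) * (r : ℝ) ^ n / n.factorial)) r := by
    -- The term `n = 0` vanishes, and `n r^n / n! = r · r^(n-1) / (n-1)!` reduces the mean to the
    -- total mass.
    rw [← hasSum_nat_add_iff' 1]
    have h2 := (hasSum_one_poissonMeasure r).mul_left (r : ℝ)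
    simp only [Finset.range_one, Finset.sum_singleton, Nat.cast_zero, zero_mul, sub_zero]
    rw [mul_one] at h2
    refine h2.congr_fun fun n => ?_
    rw [Nat.factorial_succ]
    push_cast
    have : (n.factorial : ℝ) ≠ 0 := by positivity
    field_simp
    ring
  rw [lintegral_countable']
  have : ∀ n : ℕ, (n : ℝ≥0∞) * poissonMeasure r {n} =
      ENNReal.ofReal ((n : ℝ) * (Real.exp (-r) * (r : ℝ) ^ n / n.factorial)) := by
    intro n
    rw [poissonMeasure_singleton, ENNReal.ofReal_mul (by positivity), ENNReal.ofReal_natCast]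
  simp only [this]
  rw [← ENNReal.ofReal_tsum_of_nonneg (fun n => by positivity) h1.summable, h1.tsum_eq]
  simp

theorem IsPoissonProcess.lintegral_pointCount {rate : ℝ → ℝ} {P : Measure (ℤ → ℝ)}
    [IsProbabilityMeasure P] (hP : IsPoissonProcess rate P) {B : Set ℝ} (hB : MeasurableSet B)
    (hfin : intensity rate B ≠ ∞) :
    ∫⁻ z, (pointCount B z : ℝ≥0∞) ∂P = intensity rate B := by
  rw [← lintegral_map measurable_toENNReal (measurable_pointCount hB), hP.map_pointCount hB hfin,
    lintegral_map measurable_toENNReal measurable_from_top]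
  simp only [ENat.toENNReal_coe]
  rw [lintegral_poissonMeasure_cast, ENNReal.coe_toNNReal hfin]

theorem IsPoissonProcess.ae_ne {rate : ℝ → ℝ} {P : Measure (ℤ → ℝ)}
    [IsProbabilityMeasure P] (hP : IsPoissonProcess rate P) (c : ℝ) : ∀ᵐ z ∂P, ∀ i, z i ≠ c := by
  have h0 : intensity rate {c} = 0 := IsArrivalRate.intensity_singleton c
  have h1 : ∫⁻ z, (pointCount {c} z : ℝ≥0∞) ∂P = 0 := by
    rw [hP.lintegral_pointCount (measurableSet_singleton c) (by simp [h0]), h0]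
  have hm : Measurable fun z => (pointCount {c} z : ℝ≥0∞) :=
    measurable_toENNReal.comp (measurable_pointCount (measurableSet_singleton c))
  rw [lintegral_eq_zero_iff hm] at h1
  filter_upwards [h1] with z hz i hi
  have : {i : ℤ | z i ∈ ({c} : Set ℝ)} = ∅ := by simpa [pointCount] using hz
  exact (this ▸ (show i ∈ {i : ℤ | z i ∈ ({c} : Set ℝ)} from hi) : i ∈ (∅ : Set ℤ))

/-- The part of the line that lies in `C i` exactly for the indices `i ∈ a`. -/
def atom {ι : Type*} (C : ι → Set ℝ) (a : Finset ι) : Set ℝ := {u | ∀ i, u ∈ C i ↔ i ∈ a}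

theorem measurableSet_atom {ι : Type*} [Finite ι] {C : ι → Set ℝ} (hC : ∀ i, MeasurableSet (C i))
    (a : Finset ι) : MeasurableSet (atom C a) := by
  have : atom C a = ⋂ i, {u | u ∈ C i ↔ i ∈ a} := by ext; simp [atom]
  rw [this]
  exact MeasurableSet.iInter fun i => (hC i).iff (.const _)

theorem pairwise_disjoint_atom {ι : Type*} (C : ι → Set ℝ) :
    Pairwise (fun a b => Disjoint (atom C a) (atom C b)) := by
  intro a b hab
  refine disjoint_left.2 fun u hu hu' => hab ?_
  ext i
  rw [← hu i, hu' i]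

theorem pointCount_eq_sum_atom {ι : Type*} [Fintype ι] [DecidableEq ι] (C : ι → Set ℝ) (i : ι)
    (z : ℤ → ℝ) : pointCount (C i) z =
      ∑ a : {a : Finset ι // a.Nonempty}, if i ∈ a.1 then pointCount (atom C a) z else 0 := by
  classical
  have hU : {k : ℤ | z k ∈ C i} =
      ⋃ a ∈ (Finset.univ.filter fun a : {a : Finset ι // a.Nonempty} => i ∈ a.1),
        {k : ℤ | z k ∈ atom C a} := by
    ext k
    simp only [mem_ofPred_eq, mem_iUnion, Finset.mem_filter, Finset.mem_univ, true_and, exists_prop]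
    constructor
    · intro hk
      refine ⟨⟨Finset.univ.filter fun j => z k ∈ C j, ⟨i, by simpa using hk⟩⟩, by simpa using hk, ?_⟩
      intro j
      simp
    · rintro ⟨a, hia, ha⟩
      exact (ha i).2 hia
  have hcard : ∀ s : Finset {a : Finset ι // a.Nonempty},
      (⋃ a ∈ s, {k : ℤ | z k ∈ atom C a}).encard = ∑ a ∈ s, pointCount (atom C a) z := by
    intro s
    induction s using Finset.induction_on with
    | empty => simp
    | insert b s hb ih =>
      rw [Finset.sum_insert hb, Finset.set_biUnion_insert, encard_union_eq, ih]
      · rfl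
      · refine disjoint_left.2 fun k hk hk' => ?_
        simp only [mem_iUnion, exists_prop] at hk'
        obtain ⟨a, has, ha⟩ := hk'
        have hne : b.1 ≠ a.1 := fun h => hb (Subtype.ext h ▸ has)
        exact disjoint_left.1 (pairwise_disjoint_atom C hne) hk ha
  rw [pointCount, hU, hcard, Finset.sum_filter]

theorem IsPoissonProcess.iIndepFun_pointCount {rate : ℝ → ℝ} {P : Measure (ℤ → ℝ)}
    (hP : IsPoissonProcess rate P) {ι : Type*} [Fintype ι] {B : ι → Set ℝ}
    (hB : ∀ k, MeasurableSet (B k)) (hfin : ∀ k, intensity rate (B k) ≠ ∞)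
    (hd : Pairwise (fun k l => Disjoint (B k) (B l))) :
    iIndepFun (fun k => pointCount (B k)) P := by
  let e := Fintype.equivFin ι
  have h := hP.count_indep (Fintype.card ι) (fun k => B (e.symm k)) (fun k => hB _)
    (fun k => hfin _) (fun k l hkl => hd (e.symm.injective.ne hkl))
  have h2 := h.precomp e.injective
  simpa using h2

/-- The joint law of the numbers of points in finitely many sets depends only on the intensities of
the atoms of the algebra that they generate. -/
theorem IsPoissonProcess.map_pointCount_congr {rate : ℝ → ℝ} {P : Measure (ℤ → ℝ)}
    [IsProbabilityMeasure P] (hP : IsPoissonProcess rate P) {ι : Type*} [Fintype ι]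
    {C D : ι → Set ℝ} (hC : ∀ i, MeasurableSet (C i)) (hD : ∀ i, MeasurableSet (D i))
    (hfin : ∀ i, intensity rate (C i) ≠ ∞)
    (hCD : ∀ a : Finset ι, intensity rate (atom D a) = intensity rate (atom C a)) :
    P.map (fun z i => pointCount (C i) z) = P.map (fun z i => pointCount (D i) z) := by
  classical
  -- The empty index set is left out: its atom is the complement of all the sets, which may have
  -- infinite intensity, and it contributes to no count.
  let J := {a : Finset ι // a.Nonempty}
  let g : (J → ℕ∞) → ι → ℕ∞ := fun n i => ∑ a : J, if i ∈ a.1 then n a else 0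
  have hg : Measurable g := by
    refine measurable_pi_lambda _ fun i => Finset.measurable_sum _ fun a _ => ?_
    split_ifs
    · exact measurable_pi_apply a
    · exact measurable_const
  have key : ∀ E : ι → Set ℝ, (∀ i, MeasurableSet (E i)) →
      P.map (fun z i => pointCount (E i) z) =
        (P.map fun z (a : J) => pointCount (atom E a) z).map g := by
    intro E hE
    rw [Measure.map_map hg (measurable_pi_lambda _ fun a =>
      measurable_pointCount (measurableSet_atom hE _))]
    congr 1
    funext z i
    exact pointCount_eq_sum_atom E i z
  have hfinC : ∀ a : J, intensity rate (atom C a) ≠ ∞ := by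
    rintro ⟨a, i, hi⟩
    exact measure_ne_top_of_subset (fun u hu => (hu i).2 hi) (hfin i)
  have hfinD : ∀ a : J, intensity rate (atom D a) ≠ ∞ := fun a => hCD a ▸ hfinC a
  have hJ : ∀ E : ι → Set ℝ, (∀ i, MeasurableSet (E i)) →
      (∀ a : J, intensity rate (atom E a) ≠ ∞) →
      (P.map fun z (a : J) => pointCount (atom E a) z) = Measure.pi fun a : J =>
        (poissonMeasure (intensity rate (atom E a)).toNNReal).map (Nat.cast : ℕ → ℕ∞) := by
    intro E hE hEf
    have hind := hP.iIndepFun_pointCount (B := fun a : J => atom E a)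
      (fun a => measurableSet_atom hE _) hEf
      (fun a b hab => pairwise_disjoint_atom E (fun h => hab (Subtype.ext h)))
    rw [(iIndepFun_iff_map_fun_eq_pi_map fun a =>
      (measurable_pointCount (measurableSet_atom hE _)).aemeasurable).1 hind]
    congr 1
    funext a
    exact hP.map_pointCount (measurableSet_atom hE _) (hEf a)
  rw [key C hC, key D hD, hJ C hC hfinC, hJ D hD hfinD]
  simp only [hCD]

end Counting

/-! ### Invariance of the Poisson process and of the queue length under the flow. -/

section Stationarity

/-- The bounded intervals with one endpoint `0` and the other one rational. -/
def ratInterval (q : ℚ) : Set ℝ := if 0 < q then Ioc 0 (q : ℝ) else Ioc (q : ℝ) 0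

theorem measurableSet_ratInterval (q : ℚ) : MeasurableSet (ratInterval q) := by
  unfold ratInterval
  split_ifs <;> exact measurableSet_Ioc

theorem IsArrivalRate.intensity_ratInterval_ne_top {rate : ℝ → ℝ} (h : IsArrivalRate rate) (q : ℚ) :
    intensity rate (ratInterval q) ≠ ∞ := by
  have := h.isLocallyFiniteMeasure
  unfold ratInterval
  split_ifs <;> exact measure_Ioc_lt_top.ne

/-- The numbers of points of a sequence in all the intervals `ratInterval q`. -/
noncomputable def ratCounts (z : ℤ → ℝ) (q : ℚ) : ℕ∞ := pointCount (ratInterval q) z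

/-- The sequence of points, the point with index `0` being the smallest positive one, from its
counts `ratCounts`. -/
noncomputable def reconstruct (n : ℚ → ℕ∞) (i : ℤ) : ℝ :=
  if 0 ≤ i then
    (⨅ q : ℚ, if 0 < q ∧ ((i + 1).toNat : ℕ∞) ≤ n q then ((q : ℝ) : EReal) else ⊤).toReal
  else
    (⨆ q : ℚ, if q ≤ 0 ∧ ((-i).toNat : ℕ∞) ≤ n q then ((q : ℝ) : EReal) else ⊥).toReal

theorem measurable_ratCounts : Measurable ratCounts :=
  measurable_pi_lambda _ fun q => measurable_pointCount (measurableSet_ratInterval q)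

theorem measurable_reconstruct : Measurable reconstruct := by
  classical
  have hq : ∀ (q : ℚ) (k : ℕ∞), MeasurableSet {n : ℚ → ℕ∞ | k ≤ n q} := fun q k =>
    measurable_pi_apply (X := fun _ : ℚ => ℕ∞) q
      (MeasurableSet.of_discrete (α := ℕ∞) (s := Ici k))
  refine measurable_pi_lambda _ fun i => ?_
  unfold reconstruct
  split_ifs
  · refine measurable_ereal_toReal.comp (Measurable.iInf fun q => Measurable.ite ?_
      measurable_const measurable_const)
    exact (MeasurableSet.const _).inter (hq q _)
  · refine measurable_ereal_toReal.comp (Measurable.iSup fun q => Measurable.ite ?_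
      measurable_const measurable_const)
    exact (MeasurableSet.const _).inter (hq q _)

/-- Let `m` be the first index with a positive point. For `i ≥ 0`, `z (i + m)` is the infimum of the
rational `q > 0` with at least `i + 1` points in `(0, q]`; for `i < 0` it is the supremum of the
rational `q ≤ 0` with at least `-i` points in `(q, 0]`. No labelling is assumed, because `θ_t`
carries points across `0` and spoils it. -/
theorem exists_reconstruct_ratCounts {z : ℤ → ℝ} (hz : StrictMono z)
    (htop : Tendsto z atTop atTop) (hbot : Tendsto z atBot atBot) :
    ∃ m : ℤ, reconstruct (ratCounts z) = fun i => z (i + m) := by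
  obtain ⟨m, hm, hmin⟩ : ∃ m : ℤ, 0 < z m ∧ ∀ j, 0 < z j → m ≤ j := by
    obtain ⟨b, hb⟩ := (hbot.eventually_le_atBot 0).exists_forall_of_atBot
    obtain ⟨a, ha⟩ := (htop.eventually_gt_atTop 0).exists
    exact Int.exists_least_of_bdd ⟨b, fun j hj => by
      by_contra! hjb; exact (hb j hjb.le).not_gt hj⟩ ⟨a, ha⟩
  have hpos : ∀ j, 0 < z j ↔ m ≤ j := fun j => ⟨hmin j, fun h => hm.trans_le (hz.monotone h)⟩
  refine ⟨m, funext fun i => ?_⟩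
  unfold reconstruct
  split_ifs with hi
  · have hcount : ∀ q : ℚ, 0 < q →
        (((i + 1).toNat : ℕ∞) ≤ ratCounts z q ↔ z (i + m) ≤ q) := by
      intro q hq
      rw [ratCounts, ratInterval, if_pos hq, pointCount]
      constructor
      · intro h
        by_contra! hlt
        have hsub : {j : ℤ | z j ∈ Ioc 0 (q : ℝ)} ⊆ (Finset.Ico m (i + m) : Finset ℤ) := by
          rintro j ⟨hj1, hj2⟩
          simp only [Finset.coe_Ico, mem_Ico]
          exact ⟨hmin j hj1, hz.lt_iff_lt.1 (hj2.trans_lt hlt)⟩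
        have := h.trans (encard_le_encard hsub)
        rw [encard_coe_eq_coe_finsetCard, Int.card_Ico, Nat.cast_le] at this
        lia
      · intro h
        have hsub : ((Finset.Icc m (i + m) : Finset ℤ) : Set ℤ) ⊆ {j : ℤ | z j ∈ Ioc 0 (q : ℝ)} := by
          intro j hj
          simp only [Finset.coe_Icc, mem_Icc] at hj
          exact ⟨(hpos j).2 hj.1, (hz.monotone hj.2).trans h⟩
        refine le_trans ?_ (encard_le_encard hsub)
        rw [encard_coe_eq_coe_finsetCard, Int.card_Icc, Nat.cast_le]
        lia
    have hzi : 0 < z (i + m) := (hpos _).2 (by lia)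
    have : (⨅ q : ℚ, if 0 < q ∧ ((i + 1).toNat : ℕ∞) ≤ ratCounts z q then ((q : ℝ) : EReal)
        else ⊤) = (z (i + m) : EReal) := by
      refine le_antisymm ?_ (le_iInf fun q => ?_)
      · by_contra! hlt
        obtain ⟨q, hq1, hq2⟩ := EReal.lt_iff_exists_rat_btwn.1 hlt
        have hq1' : z (i + m) < q := EReal.coe_lt_coe_iff.1 hq1
        have hq0 : 0 < q := by exact_mod_cast hzi.trans hq1'
        refine (hq2.trans_le (iInf_le _ q)).ne ?_
        rw [if_pos ⟨hq0, (hcount q hq0).2 hq1'.le⟩]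
      · split_ifs with h
        · exact EReal.coe_le_coe_iff.2 ((hcount q h.1).1 h.2)
        · exact le_top
    rw [this, EReal.toReal_coe]
  · have hcount : ∀ q : ℚ, q ≤ 0 →
        (((-i).toNat : ℕ∞) ≤ ratCounts z q ↔ (q : ℝ) < z (i + m)) := by
      intro q hq
      rw [ratCounts, ratInterval, if_neg hq.not_gt, pointCount]
      constructor
      · intro h
        by_contra! hlt
        have hsub : {j : ℤ | z j ∈ Ioc (q : ℝ) 0} ⊆ (Finset.Ioo (i + m) m : Finset ℤ) := by
          rintro j ⟨hj1, hj2⟩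
          simp only [Finset.coe_Ioo, mem_Ioo]
          exact ⟨hz.lt_iff_lt.1 (hlt.trans_lt hj1), not_le.1 fun h => ((hpos j).2 h).not_ge hj2⟩
        have := h.trans (encard_le_encard hsub)
        rw [encard_coe_eq_coe_finsetCard, Int.card_Ioo, Nat.cast_le] at this
        lia
      · intro h
        have hsub : ((Finset.Ico (i + m) m : Finset ℤ) : Set ℤ) ⊆ {j : ℤ | z j ∈ Ioc (q : ℝ) 0} := by
          intro j hj
          simp only [Finset.coe_Ico, mem_Ico] at hj
          exact ⟨h.trans_le (hz.monotone hj.1), not_lt.1 fun h => ((hpos j).1 h).not_gt hj.2⟩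
        refine le_trans ?_ (encard_le_encard hsub)
        rw [encard_coe_eq_coe_finsetCard, Int.card_Ico, Nat.cast_le]
        lia
    have hzi : z (i + m) ≤ 0 := not_lt.1 fun h => by have := hmin _ h; lia
    have : (⨆ q : ℚ, if q ≤ 0 ∧ ((-i).toNat : ℕ∞) ≤ ratCounts z q then ((q : ℝ) : EReal)
        else ⊥) = (z (i + m) : EReal) := by
      refine le_antisymm (iSup_le fun q => ?_) ?_
      · split_ifs with h
        · exact EReal.coe_le_coe_iff.2 ((hcount q h.1).1 h.2).le
        · exact bot_le
      · by_contra! hlt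
        obtain ⟨q, hq1, hq2⟩ := EReal.lt_iff_exists_rat_btwn.1 hlt
        have hq2' : (q : ℝ) < z (i + m) := EReal.coe_lt_coe_iff.1 hq2
        have hq0 : q ≤ 0 := by exact_mod_cast hq2'.le.trans hzi
        refine ((le_iSup _ q).trans_lt hq1).ne ?_
        rw [if_pos ⟨hq0, (hcount q hq0).2 hq2'⟩]
    rw [this, EReal.toReal_coe]

theorem measurable_comp_lineShift {rate : ℝ → ℝ} (h : IsArrivalRate rate) (t : ℝ) :
    Measurable (fun (z : ℤ → ℝ) i => lineShift rate t (z i)) :=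
  measurable_pi_lambda _ fun i => (h.measurable_lineShift t).comp (measurable_pi_apply i)

/-- The nonlinear shift preserves the law of the counts of a Poisson process. -/
theorem IsPoissonProcess.map_ratCounts_lineShift {rate : ℝ → ℝ} {P : Measure (ℤ → ℝ)}
    [IsProbabilityMeasure P] (hP : IsPoissonProcess rate P) (h : IsArrivalRate rate) (t : ℝ) :
    P.map (fun z : ℤ → ℝ => ratCounts (fun i => lineShift rate t (z i))) = P.map ratCounts := by
  have hm : Measurable (fun z : ℤ → ℝ => ratCounts (fun i => lineShift rate t (z i))) :=
    measurable_ratCounts.comp (measurable_comp_lineShift h t)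
  have := Measure.isProbabilityMeasure_map (μ := P) measurable_ratCounts.aemeasurable
  have hr : ∀ J : Finset ℚ, Measurable (J.restrict (π := fun _ => ℕ∞)) := fun J =>
    Finset.measurable_restrict J
  have hfin : ∀ J : Finset ℚ, IsFiniteMeasure ((P.map ratCounts).map (J.restrict (π := fun _ => ℕ∞)))
    := fun J => inferInstance
  -- A law on `ℚ → ℕ∞` is determined by its finite-dimensional marginals, which are joint laws of
  -- finitely many counts.
  refine IsProjectiveLimit.unique
    (P := fun J : Finset ℚ => (P.map ratCounts).map (J.restrict (π := fun _ => ℕ∞)))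
    (fun J => ?_) (fun J => rfl)
  beta_reduce
  rw [Measure.map_map (hr J) hm, Measure.map_map (hr J) measurable_ratCounts]
  refine (hP.map_pointCount_congr (C := fun q : J => ratInterval q)
    (D := fun q : J => lineShift rate t ⁻¹' ratInterval q)
    (fun q => measurableSet_ratInterval q)
    (fun q => h.measurable_lineShift t (measurableSet_ratInterval q))
    (fun q => h.intensity_ratInterval_ne_top q) (fun a => ?_)).symm
  -- The atoms of the preimages are by definition the preimages of the atoms.
  exact h.intensity_preimage_lineShift t
    (measurableSet_atom (fun q : J => measurableSet_ratInterval q) a)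

theorem comp_add_eq_of_seqShift {β : Type*} {G : (ℤ → ℝ) → β} (hG : ∀ z, G (seqShift z) = G z)
    (m : ℤ) (z : ℤ → ℝ) : G (fun i => z (i + m)) = G z := by
  induction m using Int.induction_on generalizing z with
  | zero => simp
  | succ n ih =>
    rw [← ih z, ← hG (fun i => z (i + n))]
    congr 1
    funext i
    exact congrArg z (by lia)
  | pred n ih =>
    rw [← ih z, ← hG (fun i => z (i + (-n - 1)))]
    congr 1
    funext i
    exact congrArg z (by lia)

/-- The nonlinear shift preserves the law of a Poisson process up to relabelling. -/
theorem IsPoissonProcess.lintegral_comp_lineShift {rate : ℝ → ℝ} {P : Measure (ℤ → ℝ)}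
    [IsProbabilityMeasure P] (hP : IsPoissonProcess rate P) (h : IsArrivalRate rate) {t : ℝ}
    (ht : 0 ≤ t) {G : (ℤ → ℝ) → ℝ≥0∞} (hGm : Measurable G) (hG : ∀ z, G (seqShift z) = G z) :
    ∫⁻ z, G (fun i => lineShift rate t (z i)) ∂P = ∫⁻ z, G z ∂P := by
  -- `G` ignores the labelling, so it is a function of the counts alone.
  have key : ∀ z : ℤ → ℝ, StrictMono z → Tendsto z atTop atTop → Tendsto z atBot atBot →
      G z = G (reconstruct (ratCounts z)) := by
    intro z h1 h2 h3
    obtain ⟨m, hm⟩ := exists_reconstruct_ratCounts h1 h2 h3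
    rw [hm, comp_add_eq_of_seqShift hG]
  have h1 : ∫⁻ z, G z ∂P = ∫⁻ z, G (reconstruct (ratCounts z)) ∂P := by
    refine lintegral_congr_ae ?_
    filter_upwards [hP.strictMono, hP.tendsto_atTop, hP.tendsto_atBot] with z h1 h2 h3
    exact key z h1 h2 h3
  have h2 : ∫⁻ z, G (fun i => lineShift rate t (z i)) ∂P =
      ∫⁻ z, G (reconstruct (ratCounts fun i => lineShift rate t (z i))) ∂P := by
    refine lintegral_congr_ae ?_
    filter_upwards [hP.strictMono, hP.tendsto_atTop, hP.tendsto_atBot] with z h1 h2 h3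
    refine key _ ((h.strictMono_lineShift t).comp h1)
      (tendsto_atTop_mono (fun i => h.le_lineShift ht (z i)) h2) (Filter.tendsto_atBot.2 fun b => ?_)
    filter_upwards [h3.eventually_lt_atBot (lineShift rate (-t) b)] with i hi
    exact (h.lineShift_lt_iff.2 hi).le
  have hm : Measurable (fun z : ℤ → ℝ => ratCounts (fun i => lineShift rate t (z i))) :=
    measurable_ratCounts.comp (measurable_comp_lineShift h t)
  have hGr : Measurable fun n => G (reconstruct n) := hGm.comp measurable_reconstruct
  rw [h1, h2, ← lintegral_map hGr measurable_ratCounts, ← hP.map_ratCounts_lineShift h t,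
    lintegral_map hGr hm]

theorem measurable_busyExit (k i : ℤ) : Measurable (fun ω : Config => busyExit ω k i) := by
  unfold busyExit
  exact ((measurable_pi_apply k).comp measurable_fst).add
    (Finset.measurable_sum _ fun m _ => (measurable_pi_apply m).comp measurable_snd)

theorem measurable_shift {rate : ℝ → ℝ} (h : IsArrivalRate rate) (t : ℝ) :
    Measurable (shift rate t) :=
  ((measurable_comp_lineShift h t).comp measurable_fst).prodMk measurable_snd

theorem measurable_encard_present (x : ℝ) : Measurable (fun ω => (present x ω).encard) := by
  refine measurable_encard (p := fun i ω => ω.1 i < x ∧ ∃ k ≤ i, x ≤ busyExit ω k i) fun i => ?_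
  refine (measurableSet_lt ((measurable_pi_apply i).comp measurable_fst) measurable_const).inter ?_
  change MeasurableSet {ω : Config | ∃ k ≤ i, x ≤ busyExit ω k i}
  have : {ω : Config | ∃ k ≤ i, x ≤ busyExit ω k i} =
      ⋃ k : ℤ, ⋃ _ : k ≤ i, {ω | x ≤ busyExit ω k i} := by ext; simp
  rw [this]
  exact .iUnion fun k => .iUnion fun _ => measurableSet_le measurable_const (measurable_busyExit k i)

theorem busyExit_seqShift (z η : ℤ → ℝ) (k i : ℤ) :
    busyExit (seqShift z, seqShift η) k i = busyExit (z, η) (k + 1) (i + 1) := by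
  simp only [busyExit, seqShift]
  rw [← Finset.map_add_right_Icc, Finset.sum_map]
  rfl

theorem encard_present_seqShift (x : ℝ) (z η : ℤ → ℝ) :
    (present x (seqShift z, seqShift η)).encard = (present x (z, η)).encard := by
  have : present x (z, η) = (Equiv.addRight (1 : ℤ)) '' present x (seqShift z, seqShift η) := by
    ext i
    rw [Equiv.image_eq_preimage_symm]
    simp only [present, busyExit_seqShift, mem_ofPred_eq, mem_preimage, seqShift,
      Equiv.addRight_symm, Equiv.coe_addRight, neg_add_cancel_right]
    refine and_congr_right fun _ => ⟨?_, ?_⟩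
    · rintro ⟨k, hk, hx⟩
      exact ⟨k - 1, by lia, by simpa using hx⟩
    · rintro ⟨k, hk, hx⟩
      exact ⟨k + 1, by lia, hx⟩
  rw [this, (Equiv.addRight (1 : ℤ)).injective.encard_image]

/-- The law of the queue at `x` is invariant under the nonlinear shift. -/
theorem lintegral_present_shift {rate : ℝ → ℝ} (h : IsArrivalRate rate) {P T : Measure (ℤ → ℝ)}
    [IsProbabilityMeasure P] [IsProbabilityMeasure T] (hP : IsPoissonProcess rate P)
    (hT : IsServiceProcess T) {t : ℝ} (ht : 0 ≤ t) (x : ℝ) (f : ℕ∞ → ℝ≥0∞) :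
    ∫⁻ ω, f (present x (shift rate t ω)).encard ∂(P.prod T) =
      ∫⁻ ω, f (present x ω).encard ∂(P.prod T) := by
  have hf : Measurable fun ω => f (present x ω).encard :=
    (measurable_from_top (f := f)).comp (measurable_encard_present x)
  have hf' : Measurable fun ω => f (present x (shift rate t ω)).encard :=
    hf.comp (measurable_shift h t)
  rw [lintegral_prod _ hf.aemeasurable, lintegral_prod _ hf'.aemeasurable]
  -- Averaging over `η` makes the integrand blind to relabelling `z` alone: shifting `η` too costs
  -- nothing by stationarity, and a simultaneous shift does not change the queue length.
  refine hP.lintegral_comp_lineShift h ht (G := fun z => ∫⁻ η, f (present x (z, η)).encard ∂T)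
    hf.lintegral_prod_right' fun z => ?_
  have hmp : MeasurePreserving seqShift T T := hT.ergodic.toMeasurePreserving
  rw [← hmp.lintegral_comp (f := fun η => f (present x (seqShift z, η)).encard)
    (hf.comp measurable_prodMk_left)]
  simp only [encard_present_seqShift]

end Stationarity

/-! ### Truncation, null coincidences, and the conclusion. -/

section Main

/-- The integral of `Q` may be infinite, so it cannot be cancelled directly. Instead `min Q M + min
N (M - Q) ≤ min (N + Q) M = min (A + Q') M ≤ A + min Q' M`, the truncated queues have equal finite
integrals, and `M → ∞` by monotone convergence since `Q` is almost everywhere finite. -/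
theorem lintegral_le_of_add_eq {Ω : Type*} [MeasurableSpace Ω] {μ : Measure Ω}
    [IsFiniteMeasure μ] {A N Q Q' : Ω → ℝ≥0∞} (hA : AEMeasurable A μ) (hN : AEMeasurable N μ)
    (hQ : AEMeasurable Q μ) (hfin : ∀ᵐ ω ∂μ, Q ω ≠ ∞)
    (heq : ∀ᵐ ω ∂μ, A ω + Q' ω = N ω + Q ω)
    (hlaw : ∀ M : ℕ, ∫⁻ ω, min (Q' ω) M ∂μ = ∫⁻ ω, min (Q ω) M ∂μ) :
    ∫⁻ ω, N ω ∂μ ≤ ∫⁻ ω, A ω ∂μ := by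
  have hstep : ∀ M : ℕ, ∫⁻ ω, min (N ω) (M - Q ω) ∂μ ≤ ∫⁻ ω, A ω ∂μ := by
    intro M
    have h1 : ∫⁻ ω, min (Q ω) M + min (N ω) (M - Q ω) ∂μ ≤ ∫⁻ ω, A ω + min (Q' ω) M ∂μ := by
      refine lintegral_mono_ae ?_
      filter_upwards [heq] with ω hω
      have h2 : min (Q ω) (M : ℝ≥0∞) + min (N ω) (M - Q ω) ≤ min (N ω + Q ω) M := by
        rcases le_total (Q ω) (M : ℝ≥0∞) with hle | hle
        · rw [min_eq_left hle]
          refine le_min ?_ ?_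
          · rw [add_comm]; gcongr; exact min_le_left _ _
          · exact (add_le_add_right (min_le_right _ _) _).trans (add_tsub_cancel_of_le hle).le
        · rw [min_eq_right hle, tsub_eq_zero_of_le hle]
          simp only [zero_le, inf_of_le_right, add_zero, le_inf_iff, le_refl, and_true]
          exact hle.trans le_add_self
      refine h2.trans ?_
      rw [← hω]
      rcases le_total (Q' ω) (M : ℝ≥0∞) with hle | hle
      · rw [min_eq_left hle]; exact min_le_left _ _
      · rw [min_eq_right hle]; exact (min_le_right _ _).trans le_add_self
    rw [lintegral_add_left' (hQ.min aemeasurable_const), lintegral_add_left' hA, hlaw, add_comm] at h1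
    refine (ENNReal.add_le_add_iff_right ?_).1 h1
    refine ((lintegral_mono fun ω => min_le_right (Q ω) (M : ℝ≥0∞)).trans_lt ?_).ne
    rw [lintegral_const]
    exact ENNReal.mul_lt_top (ENNReal.natCast_lt_top M) (measure_lt_top _ _)
  have hsup : ∫⁻ ω, N ω ∂μ = ∫⁻ ω, ⨆ M : ℕ, min (N ω) (M - Q ω) ∂μ := by
    refine lintegral_congr_ae ?_
    filter_upwards [hfin] with ω hω
    rw [← inf_iSup_eq, ← ENNReal.iSup_sub, ENNReal.iSup_natCast, ENNReal.top_sub hω, inf_top_eq]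
  have hm : ∀ M : ℕ, AEMeasurable (fun ω => min (N ω) (M - Q ω)) μ := fun M =>
    hN.min (aemeasurable_const.sub hQ)
  rw [hsup, lintegral_iSup' hm
    (Eventually.of_forall fun ω M M' h => by dsimp only; gcongr)]
  exact iSup_le hstep

theorem IsArrivalRate.shift_zero {rate : ℝ → ℝ} (h : IsArrivalRate rate) (ω : Config) :
    shift rate 0 ω = ω := by
  simp [shift, h.lineShift_zero]

/-- For fixed service times the equality forces `z_k` to hit one prescribed point, a null event.
This reconciles the weak inequality in the conservation law with the strict one in `exitCrossings`.
-/
theorem ae_busyExit_shift_ne {rate : ℝ → ℝ} (h : IsArrivalRate rate) {P T : Measure (ℤ → ℝ)}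
    [IsProbabilityMeasure P] [IsProbabilityMeasure T] (hP : IsPoissonProcess rate P) (t x : ℝ) :
    ∀ᵐ ω ∂(P.prod T), ∀ k i, busyExit (shift rate t ω) k i ≠ x := by
  refine ae_all_iff.2 fun k => ae_all_iff.2 fun i => ?_
  have hm : MeasurableSet {ω : Config | busyExit (shift rate t ω) k i ≠ x} :=
    ((measurable_busyExit k i).comp (measurable_shift h t)) (measurableSet_singleton x).compl
  rw [Measure.ae_prod_iff_ae_ae hm, Measure.ae_ae_comm hm]
  refine Eventually.of_forall fun η => ?_
  filter_upwards [hP.ae_ne (lineShift rate (-t) (x - ∑ m ∈ Finset.Icc k i, η m))] with z hz he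
  refine hz k ?_
  rw [← he]
  simp [busyExit, shift, h.lineShift_neg_lineShift]

end Main

end FIFOQueue

open FIFOQueue in
theorem mainTheorem2 (rate : ℝ → ℝ) (hrate : FIFOQueue.IsArrivalRate rate)
    (P T : Measure (ℤ → ℝ)) [IsProbabilityMeasure P] [IsProbabilityMeasure T]
    (hP : FIFOQueue.IsPoissonProcess rate P) (hT : FIFOQueue.IsServiceProcess T)
    (hno : FIFOQueue.NoOverload rate (P.prod T)) (x : ℝ) :
    AEMeasurable (fun ω : FIFOQueue.Config =>
      ((FIFOQueue.exitCrossings rate 1 ω x : ℕ∞) : ℝ≥0∞)) (P.prod T) ∧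
    ∫⁻ ω, ((FIFOQueue.exitCrossings rate 1 ω x : ℕ∞) : ℝ≥0∞) ∂(P.prod T) = 1 := by
  have hη : ∀ᵐ ω ∂(P.prod T), ∀ i, 0 ≤ ω.2 i :=
    (Measure.quasiMeasurePreserving_snd.ae hT.pos).mono fun ω h i => (h i).le
  have htop := Measure.quasiMeasurePreserving_fst (ν := T) |>.ae hP.tendsto_atTop
  have hbot := Measure.quasiMeasurePreserving_fst (ν := T) |>.ae hP.tendsto_atBot
  have hres : ∀ᵐ ω ∂(P.prod T), Resolvable ω :=
    hno.mono fun ω h => by simpa [hrate.shift_zero] using h 0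
  have hres' : ∀ᵐ ω ∂(P.prod T), Resolvable (shift rate 1 ω) := hno.mono fun ω h => h 1
  have hN : AEMeasurable (fun ω : Config => (exitCrossings rate 1 ω x : ℝ≥0∞)) (P.prod T) := by
    -- The measurable version comes from substituting the maximum formula for both exit moments.
    refine ⟨fun ω => (({i : ℤ | (∀ k ≤ i, busyExit ω k i < x) ∧
      ∃ k ≤ i, x < busyExit (shift rate 1 ω) k i}.encard : ℕ∞) : ℝ≥0∞), ?_, ?_⟩
    · refine measurable_toENNReal.comp (measurable_encard fun i => ?_)
      simp only [ofPred_and, ofPred_forall, ofPred_exists]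
      refine (MeasurableSet.iInter fun k => .iInter fun _ =>
        measurableSet_lt (measurable_busyExit k i) measurable_const).inter
        (.iUnion fun k => (MeasurableSet.const _).inter ?_)
      exact measurableSet_lt measurable_const
        ((measurable_busyExit k i).comp (measurable_shift hrate 1))
    · filter_upwards [hη, hres, hres'] with ω h1 h2 h3
      simp only [exitCrossings, h3.lt_exitMoment_iff (ω := shift rate 1 ω) h1,
        ← not_le (a := x), h2.le_exitMoment_iff h1, not_exists, not_and]
  have hA : AEMeasurable (fun ω : Config =>
      (pointCount (Ico (lineShift rate (-1) x) x) ω.1 : ℝ≥0∞)) (P.prod T) :=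
    (measurable_toENNReal.comp
      ((measurable_pointCount measurableSet_Ico).comp measurable_fst)).aemeasurable
  have hQ : AEMeasurable (fun ω : Config => ((present x ω).encard : ℝ≥0∞)) (P.prod T) :=
    (measurable_toENNReal.comp (measurable_encard_present x)).aemeasurable
  have hQ' : AEMeasurable (fun ω : Config =>
      ((present x (shift rate 1 ω)).encard : ℝ≥0∞)) (P.prod T) :=
    (measurable_toENNReal.comp
      ((measurable_encard_present x).comp (measurable_shift hrate 1))).aemeasurable
  have hfin : ∀ᵐ ω ∂(P.prod T), ((present x ω).encard : ℝ≥0∞) ≠ ∞ := by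
    filter_upwards [hη, hres, htop, hbot] with ω h1 h2 h3 h4
    simpa using h2.finite_present h1 h3 h4 x
  have hfin' : ∀ᵐ ω ∂(P.prod T), ((present x (shift rate 1 ω)).encard : ℝ≥0∞) ≠ ∞ := by
    filter_upwards [hη, hres', htop, hbot] with ω h1 h2 h3 h4
    have := h2.finite_present h1
      (tendsto_atTop_mono (fun i => hrate.le_lineShift zero_le_one (ω.1 i)) h3)
      (tendsto_atBot.2 fun b => by
        filter_upwards [h4.eventually_lt_atBot (lineShift rate (-1) b)] with i hi
        exact (hrate.lineShift_lt_iff.2 hi).le) x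
    simpa using this
  have heq : ∀ᵐ ω ∂(P.prod T), (pointCount (Ico (lineShift rate (-1) x) x) ω.1 : ℝ≥0∞) +
      ((present x (shift rate 1 ω)).encard : ℝ≥0∞) =
      (exitCrossings rate 1 ω x : ℝ≥0∞) + ((present x ω).encard : ℝ≥0∞) := by
    filter_upwards [hη, hres, hres', ae_busyExit_shift_ne hrate (T := T) hP 1 x]
      with ω h1 h2 h3 h4
    have hc := h2.conservation h3 h1 rfl
      (fun i => hrate.le_lineShift zero_le_one (ω.1 i)) x
    have hA : {i | ω.1 i < x ∧ x ≤ (shift rate 1 ω).1 i}.encard =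
        pointCount (Ico (lineShift rate (-1) x) x) ω.1 := by
      simp only [shift, hrate.le_lineShift_iff, pointCount, mem_Ico, and_comm]
    have hE : {i | exitMoment ω i < x ∧ x ≤ exitMoment (shift rate 1 ω) i}.encard =
        exitCrossings rate 1 ω x := by
      have : ∀ i, x ≤ exitMoment (shift rate 1 ω) i ↔ x < exitMoment (shift rate 1 ω) i := by
        intro i
        refine ⟨fun h => lt_of_le_of_ne h ?_, le_of_lt⟩
        obtain ⟨k, -, he⟩ := h3.exists_exitMoment_eq i
        rw [he]
        exact (h4 k i).symm
      simp only [exitCrossings, this]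
    rw [hA, hE] at hc
    exact_mod_cast congrArg (fun n : ℕ∞ => (n : ℝ≥0∞)) hc
  have hlaw : ∀ M : ℕ, ∫⁻ ω, min ((present x (shift rate 1 ω)).encard : ℝ≥0∞) M ∂(P.prod T) =
      ∫⁻ ω, min ((present x ω).encard : ℝ≥0∞) M ∂(P.prod T) := fun M =>
    lintegral_present_shift hrate hP hT zero_le_one x fun n => min (n : ℝ≥0∞) M
  refine ⟨hN, ?_⟩
  -- The truncation lemma is one-sided, so it is applied a second time with old and new queues
  -- exchanged.
  have hle := lintegral_le_of_add_eq hA hN hQ hfin heq hlaw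
  have hge := lintegral_le_of_add_eq hN hA hQ' hfin' (heq.mono fun ω h => h.symm)
    (fun M => (hlaw M).symm)
  rw [le_antisymm hle hge]
  have hmA : Measurable fun z : ℤ → ℝ =>
      (pointCount (Ico (lineShift rate (-1) x) x) z : ℝ≥0∞) :=
    measurable_toENNReal.comp (measurable_pointCount measurableSet_Ico)
  have hmp : MeasurePreserving (Prod.fst : Config → ℤ → ℝ) (P.prod T) P := measurePreserving_fst
  rw [hmp.lintegral_comp hmA, hP.lintegral_pointCount measurableSet_Ico
    (by rw [hrate.intensity_Ico_lineShift]; exact ENNReal.one_ne_top),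
    hrate.intensity_Ico_lineShift]
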